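/- Let $B$ be a standard Brownian motion, let $S(t)=B(t+1)-B(t)$, $t\in[0,1]$, be the Slepian process, and for $s\in[0,1]$ let $m_s=\max_{0\le u\le s}S(u)$ be its running maximum. Let $\Phi(x)=\frac{1}{\sqrt{2\pi}}\int_{-\infty}^{x}e^{-z^2/2}\,dz$ be the standard normal distribution function and put $\bar s=\frac{s}{2-s}$. Then $m_s$ is almost surely an attained maximum and is a random variable (up to a null set). If $0<s\le 1$, then for every $m\in\mathbb{R}$ both integrals below converge and $$\mathbb{P}(m_s\le m)=\frac{1}{\sqrt{2\pi}}\int_{-\infty}^{m}e^{-x^2/2}\,\Phi\!\left(\frac{m-x}{2\sqrt{\bar s}}+\frac{m+x}{2}\sqrt{\bar s}\right)dx-\frac{1}{\sqrt{2\pi}}\,e^{-m^2/2}\int_{-\infty}^{m}\Phi\!\left(-\frac{m-x}{2\sqrt{\bar s}}+\frac{m+x}{2}\sqrt{\bar s}\right)dx.$$ If $s=0$, the same formula holds for every $m\in\mathbb{R}$ when, for $x<m$, $\frac{m-x}{2\sqrt{\bar s}}$ is read as $+\infty$, with $\Phi(+\infty)=1$ and $\Phi(-\infty)=0$; that is, $$\mathbb{P}(m_0\le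 m)=\frac{1}{\sqrt{2\pi}}\int_{-\infty}^{m}e^{-x^2/2}\,dx.$$ -/

import Mathlib

open MeasureTheory ProbabilityTheory
open scoped NNReal

/-- The Slepian process `S(t) = B(t+1) - B(t)` built from the process `B`. -/
def slepian {Ω : Type*} (B : ℝ≥0 → Ω → ℝ) (t : ℝ≥0) (ω : Ω) : ℝ :=
  B (t + 1) ω - B t ω

/-- The running maximum of `S` over `[0, s]`, as the supremum of its values there
(the maximum, for continuous paths). -/
noncomputable def runningMax {Ω : Type*} (S : ℝ≥0 → Ω → ℝ) (s : ℝ≥0) (ω : Ω) : ℝ :=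
  sSup ((fun u => S u ω) '' Set.Icc 0 s)

/-- The distribution function of the standard normal law `N(0,1)`. -/
noncomputable def stdNormalCDF (x : ℝ) : ℝ :=
  cdf (gaussianReal 0 1) x

/-- The changed time `s / (2 - s)`. -/
noncomputable def sBar (s : ℝ≥0) : ℝ :=
  (s : ℝ) / (2 - (s : ℝ))

/-! Put W(t) = (S(s) - (1-s) S(0)) / (2-s) with t = s/(2-s). Covariances show that W is a Brownian
motion independent of S(0) (`indepFun_pinnedIncrement`, `hasLaw_pinnedIncrement`), and S(s) ≤ m says
exactly that W(t) ≤ d + b t with d = (m - S(0))/2 and b = (m + S(0))/2. So the problem is the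
non-crossing of a line by Brownian motion, given S(0).

Let the terminal distance y below the line pay 1 if y ≥ 0 and -exp(-2by) if y < 0. Its expectation
after time τ from distance d is Φ(d/√τ + b√τ) - exp(-2bd) Φ(-d/√τ + b√τ) (`reflectedValue_eq`),
which vanishes at d = 0. Paths that have met the line therefore contribute nothing on average and
the others contribute 1, so that P(m_s ≤ m) is the expected payoff on S(0) < m
(`integral_indicator_forall_slepian_le`). The strong Markov property is replaced by stopping at the
first grid point above m: there only independence of one increment from the past is needed, and the
overshoot vanishes as the grid is refined.

Integrating over the law N(0,1) of S(0) = x, where x²/2 + 2bd = m²/2, gives the formula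
(`integral_slepianPayoff`, `exp_mul_reflectedValue`). -/

/-! ### The normal distribution function and exponential tilting. -/

lemma stdNormalCDF_nonneg (x : ℝ) : 0 ≤ stdNormalCDF x := cdf_nonneg _ x

lemma stdNormalCDF_le_one (x : ℝ) : stdNormalCDF x ≤ 1 := cdf_le_one _ x

lemma abs_stdNormalCDF_le_one (x : ℝ) : |stdNormalCDF x| ≤ 1 :=
  abs_le.2 ⟨by linarith [stdNormalCDF_nonneg x], stdNormalCDF_le_one x⟩

lemma monotone_stdNormalCDF : Monotone stdNormalCDF := monotone_cdf _

lemma measurable_stdNormalCDF : Measurable stdNormalCDF := monotone_stdNormalCDF.measurable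

lemma gaussianPDFReal_zero_one_le_one (x : ℝ) : gaussianPDFReal 0 1 x ≤ 1 := by
  rw [gaussianPDFReal]
  have h1 : (√(2 * Real.pi * ((1 : ℝ≥0) : ℝ)))⁻¹ ≤ 1 := by
    apply inv_le_one_of_one_le₀
    rw [Real.one_le_sqrt]
    push_cast
    nlinarith [Real.pi_gt_three]
  have h2 : Real.exp (-(x - 0) ^ 2 / (2 * ((1 : ℝ≥0) : ℝ))) ≤ 1 := by
    rw [Real.exp_le_one_iff]
    push_cast
    nlinarith [sq_nonneg x]
  exact mul_le_one₀ h1 (Real.exp_pos _).le h2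

lemma stdNormalCDF_sub_le {x y : ℝ} (h : x ≤ y) : stdNormalCDF y - stdNormalCDF x ≤ y - x := by
  have h1 : stdNormalCDF y - stdNormalCDF x = (gaussianReal 0 1).real (Set.Ioc x y) := by
    rw [stdNormalCDF, stdNormalCDF, cdf_eq_real, cdf_eq_real, ← Set.Iic_sdiff_Iic,
      measureReal_sdiff (Set.Iic_subset_Iic.2 h) measurableSet_Iic]
  rw [h1, measureReal_def, gaussianReal_apply_eq_integral 0 one_ne_zero,
    ENNReal.toReal_ofReal (integral_nonneg fun z ↦ gaussianPDFReal_nonneg _ _ _)]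
  calc ∫ z in Set.Ioc x y, gaussianPDFReal 0 1 z
      ≤ ∫ _z in Set.Ioc x y, (1 : ℝ) :=
        integral_mono (integrable_gaussianPDFReal 0 1).integrableOn
          (integrableOn_const (by simp)) gaussianPDFReal_zero_one_le_one
    _ = y - x := by simp [h]

lemma abs_stdNormalCDF_sub_le (x y : ℝ) : |stdNormalCDF y - stdNormalCDF x| ≤ |y - x| := by
  rcases le_total x y with h | h
  · rw [abs_of_nonneg (sub_nonneg.2 (monotone_stdNormalCDF h)), abs_of_nonneg (sub_nonneg.2 h)]
    exact stdNormalCDF_sub_le h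
  · rw [abs_sub_comm, abs_sub_comm y,
      abs_of_nonneg (sub_nonneg.2 (monotone_stdNormalCDF h)), abs_of_nonneg (sub_nonneg.2 h)]
    exact stdNormalCDF_sub_le h

lemma gaussianReal_real_Iic (μ : ℝ) {v : ℝ≥0} (hv : 0 < v) (c : ℝ) :
    (gaussianReal μ v).real (Set.Iic c) = stdNormalCDF ((c - μ) / √v) := by
  have h0 : 0 < √(v : ℝ) := Real.sqrt_pos.2 hv
  have h : gaussianReal μ v = (gaussianReal 0 1).map (fun x ↦ √v * x + μ) := by
    rw [show (fun x : ℝ ↦ √v * x + μ) = (fun x ↦ x + μ) ∘ (fun x ↦ √v * x) from rfl,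
      ← Measure.map_map (by fun_prop) (by fun_prop), gaussianReal_map_const_mul,
      gaussianReal_map_add_const]
    congr 1
    · simp
    · ext
      simp
  rw [h, map_measureReal_apply (by fun_prop) measurableSet_Iic, stdNormalCDF, cdf_eq_real]
  congr 1
  ext x
  simp only [Set.mem_preimage, Set.mem_Iic]
  rw [le_div_iff₀ h0, le_sub_iff_add_le, mul_comm]

lemma gaussianReal_real_Ioi (μ : ℝ) {v : ℝ≥0} (hv : 0 < v) (c : ℝ) :
    (gaussianReal μ v).real (Set.Ioi c) = stdNormalCDF ((μ - c) / √v) := by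
  have := nullSingletonClass_gaussianReal (μ := μ) hv.ne'
  have h1 : (gaussianReal μ v).real (Set.Ioi c) = (gaussianReal μ v).real (Set.Ici c) :=
    measureReal_congr Ioi_ae_eq_Ici
  have h2 : (gaussianReal μ v).real (Set.Ici c) = (gaussianReal (-μ) v).real (Set.Iic (-c)) := by
    rw [← gaussianReal_map_neg, map_measureReal_apply (by fun_prop) measurableSet_Iic]
    simp
  rw [h1, h2, gaussianReal_real_Iic _ hv]
  congr 2
  ring

lemma exp_mul_gaussianPDFReal {v : ℝ≥0} (hv : 0 < v) (c z : ℝ) :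
    gaussianPDFReal 0 v z * Real.exp (c * z) =
      Real.exp (c ^ 2 * v / 2) * gaussianPDFReal (c * v) v z := by
  have h0 : (v : ℝ) ≠ 0 := by exact_mod_cast hv.ne'
  rw [gaussianPDFReal, gaussianPDFReal, mul_assoc, ← Real.exp_add, mul_left_comm, ← Real.exp_add]
  congr 2
  field_simp
  ring

/-- Completing the square: the exponential weight moves the mean from 0 to c v, up to the constant
exp(c² v / 2). -/
lemma setIntegral_Ioi_exp_mul_gaussianReal {v : ℝ≥0} (hv : 0 < v) (c x : ℝ) :
    ∫ z in Set.Ioi x, Real.exp (c * z) ∂gaussianReal 0 v =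
      Real.exp (c ^ 2 * v / 2) * stdNormalCDF ((c * v - x) / √v) := by
  rw [← gaussianReal_real_Ioi _ hv, measureReal_def, gaussianReal_apply_eq_integral _ hv.ne',
    ENNReal.toReal_ofReal (integral_nonneg fun z ↦ gaussianPDFReal_nonneg _ _ _),
    ← integral_indicator measurableSet_Ioi, integral_gaussianReal_eq_integral_smul hv.ne',
    ← integral_const_mul, ← integral_indicator measurableSet_Ioi]
  congr 1
  ext z
  by_cases hz : z ∈ Set.Ioi x
  · simp [hz, exp_mul_gaussianPDFReal hv]
  · simp [hz]

/-! ### The reflected payoff for a sloping line. -/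

/-- The function of the terminal distance `y` to a line of slope `b` which is `1` on one side of the
line and whose expectation along Brownian motion vanishes on the line. -/
noncomputable def reflectedPayoff (b y : ℝ) : ℝ := if 0 ≤ y then 1 else -Real.exp (-2 * b * y)

/-- The expectation of `reflectedPayoff b` after time `τ`, starting from distance `d` below a line
of slope `b`. -/
noncomputable def reflectedValue (τ : ℝ≥0) (b d : ℝ) : ℝ :=
  ∫ z, reflectedPayoff b (d + b * τ - z) ∂gaussianReal 0 τ

lemma measurable_reflectedPayoff : Measurable fun p : ℝ × ℝ ↦ reflectedPayoff p.1 p.2 := by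
  unfold reflectedPayoff
  exact Measurable.ite (measurableSet_le measurable_const measurable_snd) measurable_const
    (by fun_prop)

lemma reflectedValue_eq {τ : ℝ≥0} (hτ : 0 < τ) (b d : ℝ) :
    reflectedValue τ b d = stdNormalCDF (d / √τ + b * √τ) -
      Real.exp (-2 * b * d) * stdNormalCDF (-(d / √τ) + b * √τ) := by
  have h0 : 0 < √(τ : ℝ) := Real.sqrt_pos.2 hτ
  have hs : (τ : ℝ) = √τ * √τ := (Real.mul_self_sqrt τ.2).symm
  set c := d + b * τ with hc
  have hpay (z : ℝ) : reflectedPayoff b (c - z) =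
      (Set.Iic c).indicator (fun _ ↦ (1 : ℝ)) z -
        Real.exp (-2 * b * c) * (Set.Ioi c).indicator (fun z ↦ Real.exp (2 * b * z)) z := by
    by_cases hz : z ≤ c
    · simp [reflectedPayoff, hz]
    · have hz' : c < z := not_le.1 hz
      simp only [reflectedPayoff, sub_nonneg, hz, if_false, Set.mem_Iic, Set.mem_Ioi, hz',
        Set.indicator_of_mem, Set.indicator_of_notMem, not_false_eq_true, ← Real.exp_add]
      ring_nf
  have hint : Integrable ((Set.Ioi c).indicator fun z ↦ Real.exp (2 * b * z)) (gaussianReal 0 τ) :=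
    (integrable_exp_mul_gaussianReal _).indicator measurableSet_Ioi
  unfold reflectedValue
  simp only [← hc, hpay]
  rw [integral_sub ((integrable_const _).indicator measurableSet_Iic) (hint.const_mul _),
    integral_const_mul, integral_indicator measurableSet_Iic, integral_indicator measurableSet_Ioi,
    setIntegral_Ioi_exp_mul_gaussianReal hτ, setIntegral_const, smul_eq_mul, mul_one,
    gaussianReal_real_Iic _ hτ, ← mul_assoc, ← Real.exp_add]
  have e1 : (c - 0) / √(τ : ℝ) = d / √τ + b * √τ := by
    rw [hc, sub_zero, add_div, hs, Real.sqrt_mul_self h0.le]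
    field_simp
  have e2 : (2 * b * τ - c) / √(τ : ℝ) = -(d / √τ) + b * √τ := by
    rw [hc, hs, Real.sqrt_mul_self h0.le]
    field_simp
    ring
  have e3 : -2 * b * c + (2 * b) ^ 2 * τ / 2 = -2 * b * d := by
    rw [hc]
    ring
  rw [e1, e2, e3]

/-- Quantifies the vanishing at d = 0: Φ is 1-Lipschitz and the weight exp(-2bd) is close to 1. The
bound degenerates as τ → 0, so crossings near the final time need separate care. -/
lemma abs_reflectedValue_le {τ : ℝ≥0} (hτ : 0 < τ) (b d : ℝ) :
    |reflectedValue τ b d| ≤ 2 * |d| / √τ + |1 - Real.exp (-2 * b * d)| := by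
  have h0 : 0 < √(τ : ℝ) := Real.sqrt_pos.2 hτ
  have h1 := abs_stdNormalCDF_sub_le (-(d / √τ) + b * √τ) (d / √τ + b * √τ)
  have h2 : |d / √(τ : ℝ) + b * √τ - (-(d / √τ) + b * √τ)| = 2 * |d| / √τ := by
    rw [show d / √(τ : ℝ) + b * √τ - (-(d / √τ) + b * √τ) = 2 * d / √τ by ring, abs_div, abs_mul,
      abs_of_pos h0, abs_two]
  have h3 : |(1 - Real.exp (-2 * b * d)) * stdNormalCDF (-(d / √τ) + b * √τ)| ≤
      |1 - Real.exp (-2 * b * d)| := by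
    rw [abs_mul]
    exact mul_le_of_le_one_right (abs_nonneg _) (abs_stdNormalCDF_le_one _)
  rw [reflectedValue_eq hτ, show stdNormalCDF (d / √τ + b * √τ) -
      Real.exp (-2 * b * d) * stdNormalCDF (-(d / √τ) + b * √τ) =
      (stdNormalCDF (d / √τ + b * √τ) - stdNormalCDF (-(d / √τ) + b * √τ)) +
      (1 - Real.exp (-2 * b * d)) * stdNormalCDF (-(d / √τ) + b * √τ) by ring]
  exact (abs_add_le _ _).trans (add_le_add (h2 ▸ h1) h3)

/-! ### Integrating out an independent variable. -/

lemma integral_comp_prodMk_of_indepFun {Ω E : Type*} [MeasurableSpace Ω] [MeasurableSpace E]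
    {P : Measure Ω} [IsProbabilityMeasure P] {Y : Ω → E} {N : Ω → ℝ} {ν : Measure ℝ} [SFinite ν]
    (hY : AEMeasurable Y P) (hN : HasLaw N ν P) (hYN : IndepFun Y N P) {f : E × ℝ → ℝ}
    (hf : Measurable f) (hfi : Integrable (fun ω ↦ f (Y ω, N ω)) P) :
    Integrable (fun y ↦ ∫ z, f (y, z) ∂ν) (P.map Y) ∧
      ∫ ω, f (Y ω, N ω) ∂P = ∫ y, ∫ z, f (y, z) ∂ν ∂(P.map Y) := by
  have hlaw : HasLaw (fun ω ↦ (Y ω, N ω)) ((P.map Y).prod ν) P :=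
    IndepFun.hasLaw_prod ⟨hY, rfl⟩ hN hYN
  have hi : Integrable f ((P.map Y).prod ν) := by
    rw [← hlaw.map_eq]
    exact (integrable_map_measure hf.aestronglyMeasurable hlaw.aemeasurable).2 hfi
  refine ⟨hi.integral_prod_left, ?_⟩
  rw [← integral_prod f hi, ← hlaw.integral_comp hf.aestronglyMeasurable]
  rfl

/-- Where the conditional mean given Y is at most ε, averaging over N first gains the factor ε; on
the remaining part of A only the integrand itself is available. -/
lemma abs_integral_indicator_le_of_indepFun {Ω E : Type*} [MeasurableSpace Ω] [MeasurableSpace E]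
    {P : Measure Ω} [IsProbabilityMeasure P] {Y : Ω → E} {N : Ω → ℝ} {ν : Measure ℝ} [SFinite ν]
    (hY : AEMeasurable Y P) (hN : HasLaw N ν P) (hYN : IndepFun Y N P) {f : E × ℝ → ℝ}
    (hf : Measurable f) {A : Set E} (hA : MeasurableSet A)
    (hfi : Integrable ((Y ⁻¹' A).indicator fun ω ↦ f (Y ω, N ω)) P) {ε : ℝ} (hε : 0 ≤ ε) :
    |∫ ω, (Y ⁻¹' A).indicator (fun ω ↦ f (Y ω, N ω)) ω ∂P| ≤
      ε * ∫ ω, (Y ⁻¹' A).indicator (fun _ ↦ (1 : ℝ)) ω ∂P +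
      ∫ ω, (Y ⁻¹' (A ∩ {y | ε < |∫ z, f (y, z) ∂ν|})).indicator
        (fun ω ↦ |f (Y ω, N ω)|) ω ∂P := by
  set h : E → ℝ := fun y ↦ ∫ z, f (y, z) ∂ν with hh
  have hhm : Measurable h := hf.stronglyMeasurable.integral_prod_right'.measurable
  set L : Set E := {y | ε < |h y|}
  have hL : MeasurableSet L := measurableSet_lt measurable_const hhm.abs
  have hnull {C : Set E} (hC : MeasurableSet C) : NullMeasurableSet (Y ⁻¹' C) P :=
    hY.nullMeasurable hC
  have hsplit (ω : Ω) : (Y ⁻¹' A).indicator (fun ω ↦ f (Y ω, N ω)) ω =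
      (Y ⁻¹' (A \ L)).indicator (fun ω ↦ f (Y ω, N ω)) ω +
      (Y ⁻¹' (A ∩ L)).indicator (fun ω ↦ f (Y ω, N ω)) ω := by
    by_cases h1 : Y ω ∈ A <;> by_cases h2 : Y ω ∈ L <;> simp [h1, h2]
  have hi1 : Integrable ((Y ⁻¹' (A \ L)).indicator fun ω ↦ f (Y ω, N ω)) P := by
    have := hfi.indicator₀ (hnull hL.compl)
    rwa [Set.indicator_indicator, ← Set.preimage_inter, Set.inter_comm] at this
  have hi2 : Integrable ((Y ⁻¹' (A ∩ L)).indicator fun ω ↦ f (Y ω, N ω)) P := by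
    have := hfi.indicator₀ (hnull hL)
    rwa [Set.indicator_indicator, ← Set.preimage_inter, Set.inter_comm] at this
  simp_rw [hsplit]
  rw [integral_add hi1 hi2]
  refine (abs_add_le _ _).trans (add_le_add ?_ ?_)
  · have hf' : Measurable fun q : E × ℝ ↦ (A \ L).indicator (fun _ ↦ (1 : ℝ)) q.1 * f q :=
      ((measurable_const.indicator (hA.diff hL)).comp measurable_fst).mul hf
    have heq : (Y ⁻¹' (A \ L)).indicator (fun ω ↦ f (Y ω, N ω)) =
        fun ω ↦ (A \ L).indicator (fun _ ↦ (1 : ℝ)) (Y ω) * f (Y ω, N ω) := by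
      ext ω
      by_cases h1 : Y ω ∈ A \ L
      · rw [Set.indicator_of_mem (by exact h1), Set.indicator_of_mem h1, one_mul]
      · rw [Set.indicator_of_notMem (by exact h1), Set.indicator_of_notMem h1, zero_mul]
    obtain ⟨hi3, h3⟩ := integral_comp_prodMk_of_indepFun hY hN hYN hf' (heq ▸ hi1)
    rw [heq, h3]
    simp_rw [integral_const_mul] at hi3 ⊢
    have h4 : ∫ ω, (Y ⁻¹' A).indicator (fun _ ↦ (1 : ℝ)) ω ∂P =
        ∫ y, A.indicator (fun _ ↦ (1 : ℝ)) y ∂(P.map Y) := by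
      rw [integral_map hY (measurable_const.indicator hA).aestronglyMeasurable]
      rfl
    have : IsProbabilityMeasure (P.map Y) := Measure.isProbabilityMeasure_map hY
    rw [h4, ← integral_const_mul]
    refine (abs_integral_le_integral_abs).trans (integral_mono hi3.abs
      (((integrable_const _).indicator hA).const_mul _) fun y ↦ ?_)
    by_cases h1 : y ∈ A
    · by_cases h2 : y ∈ L
      · simp [h1, h2, hε]
      · simpa [h1, h2] using not_lt.1 h2
    · simp [h1]
  · refine (abs_integral_le_integral_abs).trans (le_of_eq (integral_congr_ae ?_))
    refine Filter.Eventually.of_forall fun ω ↦ ?_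
    by_cases h1 : ω ∈ Y ⁻¹' (A ∩ L)
    · simp only [Set.indicator_of_mem h1]
    · simp only [Set.indicator_of_notMem h1, abs_zero]

/-! ### Covariances of the Slepian process and the Brownian motion inside it. -/

lemma ProbabilityTheory.IsBrownianReal.memLp_slepian {Ω : Type*} [MeasurableSpace Ω] {P : Measure Ω}
    {B : ℝ≥0 → Ω → ℝ} (hB : IsBrownianReal B P) (u : ℝ≥0) : MemLp (slepian B u) 2 P :=
  (hB.isGaussianProcess.hasGaussianLaw_fun_sub (s := u + 1) (t := u)).memLp_two

lemma ProbabilityTheory.IsBrownianReal.aemeasurable_slepian {Ω : Type*} [MeasurableSpace Ω] {P : Measure Ω}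
    {B : ℝ≥0 → Ω → ℝ} (hB : IsBrownianReal B P) (u : ℝ≥0) : AEMeasurable (slepian B u) P :=
  (hB.aemeasurable (u + 1)).sub (hB.aemeasurable u)

lemma ProbabilityTheory.IsBrownianReal.continuous_slepian {Ω : Type*} [MeasurableSpace Ω] {P : Measure Ω}
    {B : ℝ≥0 → Ω → ℝ} (hB : IsBrownianReal B P) : ∀ᵐ ω ∂P, Continuous fun u ↦ slepian B u ω := by
  filter_upwards [hB.cont] with ω h
  unfold slepian
  fun_prop

lemma ProbabilityTheory.IsBrownianReal.hasLaw_slepian {Ω : Type*} [MeasurableSpace Ω] {P : Measure Ω}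
    {B : ℝ≥0 → Ω → ℝ} (hB : IsBrownianReal B P) (u : ℝ≥0) :
    HasLaw (slepian B u) (gaussianReal 0 1) P := by
  have h := hB.hasLaw_sub (u + 1) u
  have h1 : nndist (u + 1).1 u.1 = 1 := by
    ext
    simp
  rwa [h1] at h

lemma ProbabilityTheory.IsBrownianReal.isGaussianProcess_slepian {Ω : Type*} [MeasurableSpace Ω] {P : Measure Ω}
    {B : ℝ≥0 → Ω → ℝ} (hB : IsBrownianReal B P) : IsGaussianProcess (slepian B) P := by
  classical
  exact hB.isGaussianProcess.of_isGaussianProcess fun u ↦ ⟨{u + 1, u},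
    { toFun x := x ⟨u + 1, by simp⟩ - x ⟨u, by simp⟩
      map_add' x y := by simp; abel
      map_smul' c x := by simp; ring }, fun ω ↦ by simp [slepian]⟩

lemma ProbabilityTheory.IsBrownianReal.covariance_slepian {Ω : Type*} [MeasurableSpace Ω] {P : Measure Ω}
    [IsProbabilityMeasure P] {B : ℝ≥0 → Ω → ℝ} (hB : IsBrownianReal B P) {u v : ℝ≥0} (huv : u ≤ v)
    (hv : v ≤ 1) : cov[slepian B u, slepian B v; P] = 1 + u - v := by
  have hL (t : ℝ≥0) : MemLp (fun ω ↦ B t ω) 2 P :=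
    (hB.isGaussianProcess.hasGaussianLaw_eval t).memLp_two
  have h := covariance_fun_sub_fun_sub (hL (u + 1)) (hL u) (hL (v + 1)) (hL v)
  simp_rw [hB.covariance_fun_eval] at h
  have h1 : v ≤ u + 1 := hv.trans le_add_self
  rw [min_eq_left (by gcongr : u + 1 ≤ v + 1), min_eq_right h1,
    min_eq_left (huv.trans le_self_add), min_eq_left huv] at h
  refine h.trans ?_
  push_cast
  ring

/-- The increment over the time interval from `u / (2 - u)` to `s / (2 - s)` of the Brownian motion
obtained from the Slepian process by removing its initial value and changing time. -/
noncomputable def pinnedIncrement {Ω : Type*} (B : ℝ≥0 → Ω → ℝ) (s u : ℝ≥0) (ω : Ω) : ℝ :=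
  (2 - (s : ℝ))⁻¹ * slepian B s ω - (2 - (u : ℝ))⁻¹ * slepian B u ω +
    (sBar s - sBar u) / 2 * slepian B 0 ω

lemma ProbabilityTheory.IsBrownianReal.covariance_pinnedIncrement {Ω : Type*} [MeasurableSpace Ω]
    {P : Measure Ω} [IsProbabilityMeasure P] {B : ℝ≥0 → Ω → ℝ} (hB : IsBrownianReal B P)
    (s u : ℝ≥0) {X : Ω → ℝ} (hX : MemLp X 2 P) :
    cov[X, pinnedIncrement B s u; P] = (2 - (s : ℝ))⁻¹ * cov[X, slepian B s; P] -
      (2 - (u : ℝ))⁻¹ * cov[X, slepian B u; P] +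
      (sBar s - sBar u) / 2 * cov[X, slepian B 0; P] := by
  have hL (t : ℝ≥0) (c : ℝ) : MemLp (fun ω ↦ c * slepian B t ω) 2 P :=
    (hB.memLp_slepian t).const_mul c
  have h := covariance_add_right hX ((hL s (2 - (s : ℝ))⁻¹).sub (hL u (2 - (u : ℝ))⁻¹))
    (hL 0 ((sBar s - sBar u) / 2))
  rw [covariance_sub_right hX (hL _ _) (hL _ _), covariance_const_mul_right,
    covariance_const_mul_right, covariance_const_mul_right] at h
  exact h

/-- Since (1+v-s)/(2-s) = 1 - (1-v)/(2-s) and 1/(2-s) = (1 + `sBar s`)/2, the first two terms leave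
-(1-v)(`sBar s` - `sBar u`)/2, which the S(0) term cancels. -/
lemma ProbabilityTheory.IsBrownianReal.covariance_slepian_pinnedIncrement {Ω : Type*} [MeasurableSpace Ω]
    {P : Measure Ω} [IsProbabilityMeasure P] {B : ℝ≥0 → Ω → ℝ} (hB : IsBrownianReal B P)
    {s u v : ℝ≥0} (hvu : v ≤ u) (hus : u ≤ s) (hs : s ≤ 1) :
    cov[slepian B v, pinnedIncrement B s u; P] = 0 := by
  rw [hB.covariance_pinnedIncrement s u (hB.memLp_slepian v), hB.covariance_slepian (hvu.trans hus) hs, hB.covariance_slepian hvu (hus.trans hs),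
    covariance_comm, hB.covariance_slepian zero_le ((hvu.trans hus).trans hs)]
  have h1 : (s : ℝ) ≤ 1 := hs
  have h2 : (u : ℝ) ≤ s := hus
  have h3 : (2 - (s : ℝ)) ≠ 0 := by linarith
  have h4 : (2 - (u : ℝ)) ≠ 0 := by linarith
  unfold sBar
  push_cast
  field_simp
  ring

/-- For jointly Gaussian families, zero covariance is independence; the whole past up to u is
covered at once. -/
lemma ProbabilityTheory.IsBrownianReal.indepFun_pinnedIncrement {Ω : Type*} [MeasurableSpace Ω]
    {P : Measure Ω} [IsProbabilityMeasure P] {B : ℝ≥0 → Ω → ℝ} (hB : IsBrownianReal B P)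
    {s u : ℝ≥0} (hus : u ≤ s) (hs : s ≤ 1) :
    IndepFun (fun ω (v : Set.Iic u) ↦ slepian B v ω) (pinnedIncrement B s u) P := by
  classical
  have hm := hB.aemeasurable_slepian
  have h : IndepFun (fun ω (v : Set.Iic u) ↦ slepian B v ω)
      (fun ω (_ : Unit) ↦ pinnedIncrement B s u ω) P := by
    apply IsGaussianProcess.indepFun_of_covariance_eq_zero
      (X := fun v : Set.Iic u ↦ slepian B v) (Y := fun _ : Unit ↦ pinnedIncrement B s u)
    · apply hB.isGaussianProcess_slepian.of_isGaussianProcess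
      rintro (⟨v, hv⟩ | _)
      · exact ⟨{v},
          { toFun x := x ⟨v, by simp⟩
            map_add' x y := by simp
            map_smul' c x := by simp }, by simp⟩
      · exact ⟨{s, u, 0},
          { toFun x := (2 - (s : ℝ))⁻¹ * x ⟨s, by simp⟩ - (2 - (u : ℝ))⁻¹ * x ⟨u, by simp⟩ +
              (sBar s - sBar u) / 2 * x ⟨0, by simp⟩
            map_add' x y := by simp; ring
            map_smul' c x := by simp; ring }, by simp [pinnedIncrement]⟩
    · exact fun v ↦ hm v
    · exact fun _ ↦ (((hm s).const_mul _).sub ((hm u).const_mul _)).add ((hm 0).const_mul _)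
    · rintro ⟨v, hv⟩ _
      exact hB.covariance_slepian_pinnedIncrement hv hus hs
  exact h.comp measurable_id (measurable_pi_apply ())

lemma ProbabilityTheory.IsBrownianReal.hasLaw_pinnedIncrement {Ω : Type*} [MeasurableSpace Ω]
    {P : Measure Ω} [IsProbabilityMeasure P] {B : ℝ≥0 → Ω → ℝ} (hB : IsBrownianReal B P)
    {s u : ℝ≥0} (hus : u ≤ s) (hs : s ≤ 1) :
    HasLaw (pinnedIncrement B s u) (gaussianReal 0 (sBar s - sBar u).toNNReal) P := by
  classical
  have hL := hB.memLp_slepian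
  have hG : HasGaussianLaw (pinnedIncrement B s u) P := by
    refine (hB.isGaussianProcess_slepian.of_isGaussianProcess
      (Y := fun _ : Unit ↦ pinnedIncrement B s u) fun _ ↦ ⟨{s, u, 0},
        { toFun x := (2 - (s : ℝ))⁻¹ * x ⟨s, by simp⟩ - (2 - (u : ℝ))⁻¹ * x ⟨u, by simp⟩ +
            (sBar s - sBar u) / 2 * x ⟨0, by simp⟩
          map_add' x y := by simp; ring
          map_smul' c x := by simp; ring }, by simp [pinnedIncrement]⟩).hasGaussianLaw_eval ()
  have hint (t : ℝ≥0) : Integrable (slepian B t) P := (hL t).integrable one_le_two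
  have h0 (t : ℝ≥0) : ∫ ω, slepian B t ω ∂P = 0 := by
    rw [(hB.hasLaw_slepian t).integral_eq, integral_id_gaussianReal]
  have hmean : P[pinnedIncrement B s u] = 0 := by
    have hi (t : ℝ≥0) (c : ℝ) : Integrable (fun ω ↦ c * slepian B t ω) P := (hint t).const_mul c
    have h := integral_add ((hi s (2 - (s : ℝ))⁻¹).sub (hi u (2 - (u : ℝ))⁻¹))
      (hi 0 ((sBar s - sBar u) / 2))
    rw [integral_sub' (hi _ _) (hi _ _), integral_const_mul, integral_const_mul,
      integral_const_mul, h0, h0, h0] at h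
    simpa [pinnedIncrement] using h
  have hN : MemLp (pinnedIncrement B s u) 2 P := hG.memLp_two
  have h1 : (s : ℝ) ≤ 1 := hs
  have h2 : (u : ℝ) ≤ s := hus
  have h3 : (2 - (s : ℝ)) ≠ 0 := by linarith
  have h4 : (2 - (u : ℝ)) ≠ 0 := by linarith
  have hcov : cov[slepian B s, pinnedIncrement B s u; P] = (2 - (s : ℝ)) * (sBar s - sBar u) := by
    rw [hB.covariance_pinnedIncrement s u (hB.memLp_slepian s), hB.covariance_slepian le_rfl hs, covariance_comm, hB.covariance_slepian hus hs,
      covariance_comm, hB.covariance_slepian zero_le hs]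
    unfold sBar
    push_cast
    field_simp
    ring
  -- The increment is orthogonal to S(u) and S(0), so only its S(s) component contributes.
  have hvar : Var[pinnedIncrement B s u; P] = sBar s - sBar u := by
    rw [← covariance_self hN.aemeasurable, hB.covariance_pinnedIncrement s u hN,
      covariance_comm, hcov, covariance_comm, hB.covariance_slepian_pinnedIncrement le_rfl hus hs,
      covariance_comm, hB.covariance_slepian_pinnedIncrement zero_le hus hs]
    field_simp
    ring
  exact ⟨hN.aemeasurable, by rw [hG.map_eq_gaussianReal, hmean, hvar]⟩

/-! ### The time change and regular subdivisions. -/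

/-- The derivative 2/(2-s)² of the time change is at least 1/2 on [0,1]. -/
lemma sBar_sub_sBar_ge {s u : ℝ≥0} (hus : u ≤ s) (hs : s ≤ 1) :
    ((s : ℝ) - u) / 2 ≤ sBar s - sBar u := by
  have h1 : (s : ℝ) ≤ 1 := hs
  have h2 : (u : ℝ) ≤ s := hus
  have h3 : 0 < 2 - (s : ℝ) := by linarith
  have h4 : 0 < 2 - (u : ℝ) := by linarith
  have h5 : sBar s - sBar u = 2 * (s - u) / ((2 - (s : ℝ)) * (2 - u)) := by
    unfold sBar
    field_simp
    ring
  have h6 : (0 : ℝ) ≤ s := s.2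
  have h7 : (0 : ℝ) ≤ u := u.2
  rw [h5, div_le_div_iff₀ two_pos (by positivity)]
  have : (2 - (s : ℝ)) * (2 - u) ≤ 2 * 2 :=
    mul_le_mul (by linarith) (by linarith) h4.le two_pos.le
  nlinarith [sub_nonneg.2 h2]

@[simp]
lemma sBar_zero : sBar 0 = 0 := by simp [sBar]

lemma sBar_pos {s : ℝ≥0} (h0 : 0 < s) (hs : s ≤ 1) : 0 < sBar s := by
  have h := sBar_sub_sBar_ge (zero_le (a := s)) hs
  have h1 : (0 : ℝ) < s := h0
  rw [sBar_zero] at h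
  push_cast at h
  linarith

/-- The `k`-th point of the regular subdivision of `[0, s]` into `n + 1` intervals. -/
noncomputable def subdivision (s : ℝ≥0) (n k : ℕ) : ℝ≥0 := s * k / (n + 1)

@[simp]
lemma subdivision_zero (s : ℝ≥0) (n : ℕ) : subdivision s n 0 = 0 := by simp [subdivision]

@[simp]
lemma subdivision_last (s : ℝ≥0) (n : ℕ) : subdivision s n (n + 1) = s := by
  unfold subdivision
  push_cast
  field_simp

lemma monotone_subdivision (s : ℝ≥0) (n : ℕ) : Monotone (subdivision s n) := by
  intro i j hij
  unfold subdivision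
  gcongr

lemma subdivision_le (s : ℝ≥0) {n k : ℕ} (hk : k ≤ n + 1) : subdivision s n k ≤ s :=
  (monotone_subdivision s n hk).trans (subdivision_last s n).le

lemma dist_subdivision_succ (s : ℝ≥0) (n k : ℕ) :
    dist (subdivision s n (k + 1)) (subdivision s n k) = s / (n + 1) := by
  rw [NNReal.dist_eq]
  unfold subdivision
  push_cast
  rw [show (s : ℝ) * (k + 1) / (n + 1) - s * k / (n + 1) = s / (n + 1) by ring]
  exact abs_of_nonneg (by positivity)

lemma exists_dist_subdivision_le {s u : ℝ≥0} (hu : u ≤ s) (n : ℕ) :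
    ∃ k ≤ n + 1, dist (subdivision s n k) u ≤ s / (n + 1) := by
  by_contra! h
  have key (k : ℕ) : k ≤ n + 1 → subdivision s n k < u := by
    induction k with
    | zero =>
      intro hk
      refine lt_of_le_of_ne (by simp) fun h0 ↦ ?_
      have := h 0 hk
      rw [h0, dist_self] at this
      exact absurd this (not_lt.2 (by positivity))
    | succ k ih =>
      intro hk
      by_contra! hlt
      have h1 := ih (by omega)
      have h2 := h (k + 1) hk
      rw [← dist_subdivision_succ s n k, NNReal.dist_eq, NNReal.dist_eq] at h2
      have h1' : (subdivision s n k : ℝ) < u := h1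
      have hlt' : (u : ℝ) ≤ subdivision s n (k + 1) := hlt
      rw [abs_of_nonneg (by linarith), abs_of_nonneg (by linarith)] at h2
      linarith
  have := key (n + 1) le_rfl
  rw [subdivision_last] at this
  exact absurd hu (not_le.2 this)

lemma tendsto_div_succ (s : ℝ≥0) :
    Filter.Tendsto (fun n : ℕ ↦ (s : ℝ) / (n + 1)) Filter.atTop (nhds 0) := by
  have := tendsto_one_div_add_atTop_nhds_zero_nat (𝕜 := ℝ) |>.const_mul (s : ℝ)
  simpa [div_eq_mul_inv] using this

/-! ### First exceedance along a subdivision. -/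

/-- The event that the path starts below `m` and, along the subdivision, exceeds `m` for the first
time at the `k`-th point. -/
def firstExceedance {Ω : Type*} (S : ℝ≥0 → Ω → ℝ) (s : ℝ≥0) (m : ℝ) (n k : ℕ) : Set Ω :=
  {ω | S 0 ω < m ∧ m < S (subdivision s n k) ω ∧ ∀ j < k, S (subdivision s n j) ω ≤ m}

/-- The event that the path starts below `m` and never exceeds `m` along the subdivision. -/
def staysBelow {Ω : Type*} (S : ℝ≥0 → Ω → ℝ) (s : ℝ≥0) (m : ℝ) (n : ℕ) : Set Ω :=
  {ω | S 0 ω < m ∧ ∀ j ≤ n + 1, S (subdivision s n j) ω ≤ m}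

/-- The events partition {S(0) < m} by the index of first exceedance; index 0 is kept only for
uniformity, its event being empty. -/
lemma indicator_eq_staysBelow_add_sum {Ω : Type*} (S : ℝ≥0 → Ω → ℝ) (s : ℝ≥0) (m : ℝ) (n : ℕ)
    (f : Ω → ℝ) (ω : Ω) :
    {ω | S 0 ω < m}.indicator f ω = (staysBelow S s m n).indicator f ω +
      ∑ k ∈ Finset.range (n + 2), (firstExceedance S s m n k).indicator f ω := by
  classical
  by_cases h0 : S 0 ω < m
  · by_cases h : ∃ k, k ≤ n + 1 ∧ m < S (subdivision s n k) ω
    · have hk := Nat.find_spec h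
      have hmin (j : ℕ) (hj : j < Nat.find h) : S (subdivision s n j) ω ≤ m := by
        have := Nat.find_min h hj
        push Not at this
        exact this (by omega)
      have h1 : ω ∉ staysBelow S s m n := fun hω ↦ absurd (hω.2 _ hk.1) (not_le.2 hk.2)
      rw [Finset.sum_eq_single (Nat.find h)]
      · have h2 : ω ∈ firstExceedance S s m n (Nat.find h) := ⟨h0, hk.2, hmin⟩
        rw [Set.indicator_of_mem h2, Set.indicator_of_notMem h1, Set.indicator_of_mem (by exact h0),
          zero_add]
      · intro j _ hj
        refine Set.indicator_of_notMem (fun hω ↦ ?_) _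
        rcases lt_or_gt_of_ne hj with hlt | hlt
        · exact absurd (hmin j hlt) (not_le.2 hω.2.1)
        · exact absurd (hω.2.2 _ hlt) (not_le.2 hk.2)
      · intro hj
        exact absurd (Finset.mem_range.2 (by omega)) hj
    · push Not at h
      have h1 : ω ∈ staysBelow S s m n := ⟨h0, h⟩
      rw [Finset.sum_eq_zero, add_zero, Set.indicator_of_mem h1,
        Set.indicator_of_mem (by exact h0)]
      intro k hk
      exact Set.indicator_of_notMem (fun hω ↦ absurd (h k (by simp at hk; omega))
        (not_le.2 hω.2.1)) _
  · rw [Set.indicator_of_notMem (by exact h0), Set.indicator_of_notMem (fun hω ↦ h0 hω.1),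
      Finset.sum_eq_zero, add_zero]
    exact fun k _ ↦ Set.indicator_of_notMem (fun hω ↦ h0 hω.1) _

lemma sum_indicator_firstExceedance_le {Ω : Type*} (S : ℝ≥0 → Ω → ℝ) (s : ℝ≥0) (m : ℝ) (n : ℕ)
    {f : Ω → ℝ} (hf : ∀ ω, 0 ≤ f ω) (ω : Ω) :
    ∑ k ∈ Finset.range (n + 2), (firstExceedance S s m n k).indicator f ω ≤
      {ω | S 0 ω < m}.indicator f ω := by
  rw [indicator_eq_staysBelow_add_sum S s m n f ω]
  exact le_add_of_nonneg_left (Set.indicator_nonneg (fun ω _ ↦ hf ω) _)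

lemma tendsto_indicator_staysBelow {Ω : Type*} {S : ℝ≥0 → Ω → ℝ} (s : ℝ≥0) (m : ℝ) {ω : Ω}
    (hω : Continuous fun u ↦ S u ω) :
    Filter.Tendsto (fun n ↦ (staysBelow S s m n).indicator (fun _ ↦ (1 : ℝ)) ω) Filter.atTop
      (nhds ({ω | S 0 ω < m ∧ ∀ u ≤ s, S u ω ≤ m}.indicator (fun _ ↦ (1 : ℝ)) ω)) := by
  by_cases h0 : S 0 ω < m
  · by_cases h : ∀ u ≤ s, S u ω ≤ m
    · refine tendsto_const_nhds.congr fun n ↦ ?_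
      rw [Set.indicator_of_mem (by exact ⟨h0, h⟩), Set.indicator_of_mem]
      exact ⟨h0, fun j hj ↦ h _ (subdivision_le s hj)⟩
    · have hn : ω ∉ {ω | S 0 ω < m ∧ ∀ u ≤ s, S u ω ≤ m} := fun hω ↦ h hω.2
      rw [Set.indicator_of_notMem hn]
      push Not at h
      obtain ⟨u, hu, hmu⟩ := h
      obtain ⟨δ, hδ, hball⟩ := Metric.eventually_nhds_iff.1
        (hω.continuousAt.eventually (lt_mem_nhds hmu) : ∀ᶠ v in nhds u, m < S v ω)
      refine tendsto_const_nhds.congr' ?_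
      filter_upwards [(tendsto_div_succ s).eventually (gt_mem_nhds hδ)] with n hn
      obtain ⟨k, hk, hd⟩ := exists_dist_subdivision_le hu n
      exact (Set.indicator_of_notMem
        (fun hω ↦ absurd (hω.2 k hk) (not_le.2 (hball (hd.trans_lt hn)))) _).symm
  · refine tendsto_const_nhds.congr fun n ↦ ?_
    rw [Set.indicator_of_notMem (fun hω ↦ h0 hω.1), Set.indicator_of_notMem (fun hω ↦ h0 hω.1)]

/-- If a continuous path does not end at level `m`, then eventually the value of the reflected
problem is small at the first point of the subdivision at which the path exceeds `m`. -/
lemma eventually_abs_reflectedValue_le {Ω : Type*} {S : ℝ≥0 → Ω → ℝ} {s : ℝ≥0} (hs : s ≤ 1)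
    {m : ℝ} {ω : Ω} (hω : Continuous fun u ↦ S u ω) (hend : S s ω ≠ m) {ε : ℝ} (hε : 0 < ε) :
    ∀ᶠ n in Filter.atTop, ∀ k ≤ n + 1, ω ∈ firstExceedance S s m n k →
      |reflectedValue (sBar s - sBar (subdivision s n k)).toNNReal ((m + S 0 ω) / 2)
        ((m - S (subdivision s n k) ω) / (2 - subdivision s n k))| ≤ ε := by
  have hη : 0 < |S s ω - m| / 2 := half_pos (abs_pos.2 (sub_ne_zero.2 hend))
  set b := (m + S 0 ω) / 2
  have huc := (isCompact_Icc (a := (0 : ℝ≥0)) (b := s)).uniformContinuousOn_of_continuous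
    hω.continuousOn
  rw [Metric.uniformContinuousOn_iff] at huc
  -- Within δ₁ of the end, the path stays within half the gap |S(s) - m| of its final value, which
  -- keeps crossings away from s.
  obtain ⟨δ₁, hδ₁, h1⟩ := huc _ hη
  have hcont : ContinuousAt (fun d : ℝ ↦ 2 * |d| / √(δ₁ / 2) + |1 - Real.exp (-2 * b * d)|) 0 := by
    fun_prop
  have hlt : ∀ᶠ d in nhds (0 : ℝ), 2 * |d| / √(δ₁ / 2) + |1 - Real.exp (-2 * b * d)| < ε :=
    hcont.eventually (gt_mem_nhds (by simpa using hε))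
  obtain ⟨ρ, hρ, h2⟩ := Metric.eventually_nhds_iff.1 hlt
  obtain ⟨δ₂, hδ₂, h3⟩ := huc _ (lt_min hρ hη)
  filter_upwards [(tendsto_div_succ s).eventually (gt_mem_nhds hδ₂)] with n hn k hk hmem
  obtain ⟨h0, hex, hbefore⟩ := hmem
  set u := subdivision s n k with hu
  have hus : u ≤ s := subdivision_le s hk
  have hus' : (u : ℝ) ≤ s := hus
  have hs' : (s : ℝ) ≤ 1 := hs
  -- The preceding grid value is at most m, so the overshoot is bounded by the oscillation over one
  -- mesh step.
  have hover : |S u ω - m| < min ρ (|S s ω - m| / 2) := by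
    obtain _ | j := k
    · rw [hu, subdivision_zero] at hex
      exact absurd h0 (not_lt.2 hex.le)
    · have hj := hbefore j (Nat.lt_succ_self j)
      have hd : dist u (subdivision s n j) < δ₂ := by
        rw [hu, dist_subdivision_succ]
        exact hn
      have := h3 u ⟨zero_le, hus⟩ _ ⟨zero_le, subdivision_le s (by omega)⟩ hd
      rw [Real.dist_eq] at this
      refine lt_of_le_of_lt ?_ this
      rw [abs_of_pos (by linarith), abs_of_pos (by linarith)]
      linarith
  have hfar : δ₁ ≤ (s : ℝ) - u := by
    by_contra! hc
    have hd : dist s u < δ₁ := by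
      rwa [NNReal.dist_eq, abs_of_nonneg (by linarith)]
    have h4 := h1 s ⟨zero_le, le_rfl⟩ u ⟨zero_le, hus⟩ hd
    rw [Real.dist_eq] at h4
    have h5 := abs_sub_le (S s ω) (S u ω) m
    have h6 := hover.trans_le (min_le_right _ _)
    linarith
  have hτ : δ₁ / 2 ≤ sBar s - sBar u := by
    have := sBar_sub_sBar_ge hus hs
    linarith
  have hτ0 : 0 < sBar s - sBar u := (half_pos hδ₁).trans_le hτ
  have hd : |(m - S u ω) / (2 - u)| < ρ := by
    have h7 : (1 : ℝ) ≤ 2 - u := by linarith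
    rw [abs_div, abs_sub_comm, abs_of_pos (by linarith : (0 : ℝ) < 2 - u)]
    exact (div_le_self (abs_nonneg _) h7).trans_lt (hover.trans_le (min_le_left _ _))
  refine (abs_reflectedValue_le (Real.toNNReal_pos.2 hτ0) _ _).trans
    (le_trans ?_ (h2 (by rwa [Real.dist_eq, sub_zero])).le)
  rw [Real.coe_toNNReal _ hτ0.le]
  gcongr

/-! ### The payoff of the Slepian process and its conditional mean at a first exceedance. -/

/-- The scaled distance to m moves as the distance of a Brownian motion below a line of slope (m +
S(0))/2 in the changed time. -/
lemma div_eq_add_sub_pinnedIncrement {Ω : Type*} (B : ℝ≥0 → Ω → ℝ) {s u : ℝ≥0} (hus : u ≤ s)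
    (hs : s ≤ 1) (m : ℝ) (ω : Ω) :
    (m - slepian B s ω) / (2 - s) = (m - slepian B u ω) / (2 - u) +
      (m + slepian B 0 ω) / 2 * ((sBar s - sBar u).toNNReal : ℝ) - pinnedIncrement B s u ω := by
  have h1 : (s : ℝ) ≤ 1 := hs
  have h2 : (u : ℝ) ≤ s := hus
  have h3 : (2 - (s : ℝ)) ≠ 0 := by linarith
  have h4 : (2 - (u : ℝ)) ≠ 0 := by linarith
  rw [Real.coe_toNNReal _ ((by linarith : 0 ≤ ((s : ℝ) - u) / 2).trans (sBar_sub_sBar_ge hus hs))]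
  unfold pinnedIncrement sBar
  field_simp
  ring

/-- The payoff of the reflected problem at the end of `[0, s]`, for the Slepian process below `m`. -/
noncomputable def slepianPayoff {Ω : Type*} (B : ℝ≥0 → Ω → ℝ) (s : ℝ≥0) (m : ℝ) (ω : Ω) : ℝ :=
  reflectedPayoff ((m + slepian B 0 ω) / 2) ((m - slepian B s ω) / (2 - s))

lemma aemeasurable_slepianPayoff {Ω : Type*} [MeasurableSpace Ω] {P : Measure Ω}
    {B : ℝ≥0 → Ω → ℝ} (hB : IsBrownianReal B P) (s : ℝ≥0) (m : ℝ) :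
    AEMeasurable (slepianPayoff B s m) P :=
  measurable_reflectedPayoff.comp_aemeasurable
    ((((hB.aemeasurable_slepian 0).const_add m).div_const 2).prodMk
      (((hB.aemeasurable_slepian s).const_sub m).div_const _))

lemma nullMeasurableSet_slepian_lt {Ω : Type*} [MeasurableSpace Ω] {P : Measure Ω}
    {B : ℝ≥0 → Ω → ℝ} (hB : IsBrownianReal B P) (u : ℝ≥0) (m : ℝ) :
    NullMeasurableSet {ω | slepian B u ω < m} P :=
  nullMeasurableSet_lt (hB.aemeasurable_slepian u) aemeasurable_const

/-- Provides a dominating function independent of the slope. A negative payoff has modulus at most 1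
if b ≤ 0; if b ≥ 0 it forces z ≥ 0, and the exponent is at most 2bz ≤ 2mz. -/
lemma abs_reflectedPayoff_le {a b t z m : ℝ} (ha : 0 ≤ a) (ht : 0 ≤ t) (hb : b ≤ m) :
    |reflectedPayoff b (a + b * t - z)| ≤ 1 + Real.exp (2 * m * z) := by
  have h0 := Real.exp_pos (2 * m * z)
  unfold reflectedPayoff
  split_ifs with h
  · rw [abs_one]
    linarith
  · rw [abs_neg, abs_of_pos (Real.exp_pos _)]
    have h := not_le.1 h
    rcases le_total b 0 with hb0 | hb0
    · have : Real.exp (-2 * b * (a + b * t - z)) ≤ 1 := by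
        rw [Real.exp_le_one_iff]
        nlinarith
      linarith
    · have hbt : 0 ≤ b * t := mul_nonneg hb0 ht
      have hz : 0 ≤ z := by linarith
      have : Real.exp (-2 * b * (a + b * t - z)) ≤ Real.exp (2 * m * z) := by
        rw [Real.exp_le_exp]
        nlinarith [mul_nonneg hb0 ha, mul_nonneg hb0 hbt, mul_le_mul_of_nonneg_right hb hz]
      linarith

lemma integrable_slepianPayoff {Ω : Type*} [MeasurableSpace Ω] {P : Measure Ω}
    [IsProbabilityMeasure P] {B : ℝ≥0 → Ω → ℝ} (hB : IsBrownianReal B P) {s : ℝ≥0} (hs : s ≤ 1)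
    (m : ℝ) : Integrable ({ω | slepian B 0 ω < m}.indicator (slepianPayoff B s m)) P := by
  have hlaw := hB.hasLaw_pinnedIncrement (zero_le (a := s)) hs
  have hexp : Integrable (fun ω ↦ Real.exp (2 * m * pinnedIncrement B s 0 ω)) P := by
    have h := integrable_exp_mul_gaussianReal (μ := 0) (v := (sBar s - sBar 0).toNNReal) (2 * m)
    rw [← hlaw.map_eq] at h
    exact h.comp_aemeasurable hlaw.aemeasurable
  refine ((integrable_const (1 : ℝ)).add hexp).mono'
    ((aemeasurable_slepianPayoff hB s m).aestronglyMeasurable.indicator₀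
      (nullMeasurableSet_slepian_lt hB 0 m)) (Filter.Eventually.of_forall fun ω ↦ ?_)
  by_cases h0 : slepian B 0 ω < m
  · rw [Set.indicator_of_mem (by exact h0), slepianPayoff, Real.norm_eq_abs,
      div_eq_add_sub_pinnedIncrement B zero_le hs]
    refine abs_reflectedPayoff_le ?_ (NNReal.coe_nonneg _) (by linarith)
    push_cast
    linarith
  · rw [Set.indicator_of_notMem (by exact h0), norm_zero]
    exact add_nonneg zero_le_one (Real.exp_pos _).le

lemma abs_integral_indicator_firstExceedance_le {Ω : Type*} [MeasurableSpace Ω] {P : Measure Ω}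
    [IsProbabilityMeasure P] {B : ℝ≥0 → Ω → ℝ} (hB : IsBrownianReal B P) {s : ℝ≥0} (hs : s ≤ 1)
    (m : ℝ) {n k : ℕ} (hk : k ≤ n + 1) {ε : ℝ} (hε : 0 ≤ ε) :
    NullMeasurableSet (firstExceedance (slepian B) s m n k) P ∧
    NullMeasurableSet (firstExceedance (slepian B) s m n k ∩ {ω | ε <
      |reflectedValue (sBar s - sBar (subdivision s n k)).toNNReal ((m + slepian B 0 ω) / 2)
        ((m - slepian B (subdivision s n k) ω) / (2 - subdivision s n k))|}) P ∧
    |∫ ω, (firstExceedance (slepian B) s m n k).indicator (slepianPayoff B s m) ω ∂P| ≤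
      ε * ∫ ω, (firstExceedance (slepian B) s m n k).indicator (fun _ ↦ (1 : ℝ)) ω ∂P +
      ∫ ω, (firstExceedance (slepian B) s m n k ∩ {ω | ε <
      |reflectedValue (sBar s - sBar (subdivision s n k)).toNNReal ((m + slepian B 0 ω) / 2)
        ((m - slepian B (subdivision s n k) ω) / (2 - subdivision s n k))|}).indicator
        (fun ω ↦ |slepianPayoff B s m ω|) ω ∂P := by
  set u := subdivision s n k with hu
  have hus : u ≤ s := subdivision_le s hk
  set τ := (sBar s - sBar u).toNNReal
  -- Truncating the index at k makes Y a function of the past up to u, while keeping a fixed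
  -- countable index set.
  set Y : Ω → ℕ → ℝ := fun ω j ↦ slepian B (subdivision s n (min j k)) ω with hYdef
  have hY : AEMeasurable Y P := aemeasurable_pi_lambda _ fun j ↦ hB.aemeasurable_slepian _
  have hYN : IndepFun Y (pinnedIncrement B s u) P := by
    have hle (j : ℕ) : subdivision s n (min j k) ∈ Set.Iic u :=
      monotone_subdivision s n (min_le_right j k)
    exact (hB.indepFun_pinnedIncrement hus hs).comp
      (φ := fun (y : Set.Iic u → ℝ) (j : ℕ) ↦ y ⟨subdivision s n (min j k), hle j⟩)
      (measurable_pi_lambda _ fun j ↦ measurable_pi_apply _) measurable_id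
  have hY0 (ω : Ω) : Y ω 0 = slepian B 0 ω := by simp [hYdef]
  have hYk (ω : Ω) : Y ω k = slepian B u ω := by simp [hYdef, hu]
  set A : Set (ℕ → ℝ) := {y | y 0 < m ∧ m < y k ∧ ∀ j < k, y j ≤ m} with hAdef
  have hA : MeasurableSet A := by
    have hAeq : A = {y | y 0 < m} ∩ ({y | m < y k} ∩ ⋂ j ∈ Set.Iio k, {y : ℕ → ℝ | y j ≤ m}) := by
      ext y
      simp [hAdef]
    rw [hAeq]
    exact (measurableSet_lt (measurable_pi_apply _) measurable_const).inter
      ((measurableSet_lt measurable_const (measurable_pi_apply _)).inter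
        (MeasurableSet.biInter (Set.to_countable _)
          fun j _ ↦ measurableSet_le (measurable_pi_apply _) measurable_const))
  have hYA : Y ⁻¹' A = firstExceedance (slepian B) s m n k := by
    ext ω
    change (Y ω 0 < m ∧ m < Y ω k ∧ ∀ j < k, Y ω j ≤ m) ↔ _
    rw [hY0, hYk]
    refine and_congr_right fun _ ↦ and_congr_right fun _ ↦ forall₂_congr fun j hj ↦ ?_
    simp only [hYdef, min_eq_left hj.le]
  set f : (ℕ → ℝ) × ℝ → ℝ := fun q ↦ reflectedPayoff ((m + q.1 0) / 2)
    ((m - q.1 k) / (2 - u) + (m + q.1 0) / 2 * τ - q.2) with hfdef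
  have hf : Measurable f := by
    refine measurable_reflectedPayoff.comp (Measurable.prodMk ?_ ?_) <;> fun_prop
  have hfY : (fun ω ↦ f (Y ω, pinnedIncrement B s u ω)) = slepianPayoff B s m := by
    ext ω
    simp only [hfdef, hY0, hYk]
    rw [slepianPayoff, div_eq_add_sub_pinnedIncrement B hus hs]
  have hL : Y ⁻¹' (A ∩ {y | ε < |∫ z, f (y, z) ∂gaussianReal 0 τ|}) =
      firstExceedance (slepian B) s m n k ∩ {ω | ε < |reflectedValue τ
        ((m + slepian B 0 ω) / 2) ((m - slepian B u ω) / (2 - u))|} := by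
    rw [Set.preimage_inter, hYA]
    congr 1
    ext ω
    simp only [hfdef, Set.mem_preimage, Set.mem_ofPred_eq, hY0, hYk, reflectedValue]
  have hLm : MeasurableSet {y | ε < |∫ z, f (y, z) ∂gaussianReal 0 τ|} :=
    measurableSet_lt measurable_const hf.stronglyMeasurable.integral_prod_right'.measurable.abs
  have hn1 : NullMeasurableSet (firstExceedance (slepian B) s m n k) P :=
    hYA ▸ hY.nullMeasurable hA
  have hfi : Integrable ((Y ⁻¹' A).indicator fun ω ↦ f (Y ω, pinnedIncrement B s u ω)) P := by
    rw [hfY, hYA]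
    have h := (integrable_slepianPayoff hB hs m).indicator₀ hn1
    rwa [Set.indicator_indicator, Set.inter_eq_left.2 fun ω hω ↦ hω.1] at h
  have h := abs_integral_indicator_le_of_indepFun hY (hB.hasLaw_pinnedIncrement hus hs) hYN hf hA
    hfi hε
  rw [hL, hYA, hfY] at h
  refine ⟨hn1, hL ▸ hY.nullMeasurable (hA.inter hLm), h.trans_eq ?_⟩
  rw [← hfY]

lemma nullMeasurableSet_staysBelow {Ω : Type*} [MeasurableSpace Ω] {P : Measure Ω}
    {B : ℝ≥0 → Ω → ℝ} (hB : IsBrownianReal B P) (s : ℝ≥0) (m : ℝ) (n : ℕ) :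
    NullMeasurableSet (staysBelow (slepian B) s m n) P := by
  have h : staysBelow (slepian B) s m n = {ω | slepian B 0 ω < m} ∩
      ⋂ j ∈ Set.Iic (n + 1), {ω | slepian B (subdivision s n j) ω ≤ m} := by
    ext ω
    simp [staysBelow]
  rw [h]
  exact (nullMeasurableSet_slepian_lt hB 0 m).inter (NullMeasurableSet.biInter (Set.to_countable _)
    fun j _ ↦ nullMeasurableSet_le (hB.aemeasurable_slepian _) aemeasurable_const)

lemma slepian_ne_ae {Ω : Type*} [MeasurableSpace Ω] {P : Measure Ω} {B : ℝ≥0 → Ω → ℝ}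
    (hB : IsBrownianReal B P) (u : ℝ≥0) (m : ℝ) : ∀ᵐ ω ∂P, slepian B u ω ≠ m := by
  have := nullSingletonClass_gaussianReal (μ := 0) (v := 1) one_ne_zero
  rw [(hB.hasLaw_slepian u).ae_iff (p := fun x ↦ x ≠ m) (by measurability)]
  exact Measure.ae_ne _ m

/-! ### Refining the subdivision. -/

lemma integral_indicator_forall_slepian_le {Ω : Type*} [MeasurableSpace Ω] {P : Measure Ω}
    [IsProbabilityMeasure P] {B : ℝ≥0 → Ω → ℝ} (hB : IsBrownianReal B P) {s : ℝ≥0} (hs : s ≤ 1)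
    (m : ℝ) :
    ∫ ω, {ω | slepian B 0 ω < m ∧ ∀ u ≤ s, slepian B u ω ≤ m}.indicator (fun _ ↦ (1 : ℝ)) ω ∂P =
      ∫ ω, {ω | slepian B 0 ω < m}.indicator (slepianPayoff B s m) ω ∂P := by
  have hgi := integrable_slepianPayoff hB hs m
  have hs' : (0 : ℝ) < 2 - s := by
    have : (s : ℝ) ≤ 1 := hs
    linarith
  have hstay (n : ℕ) : Integrable ((staysBelow (slepian B) s m n).indicator fun _ ↦ (1 : ℝ)) P :=
    (integrable_const _).indicator₀ (nullMeasurableSet_staysBelow hB s m n)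
  have hlim : Filter.Tendsto
      (fun n ↦ ∫ ω, (staysBelow (slepian B) s m n).indicator (fun _ ↦ (1 : ℝ)) ω ∂P) Filter.atTop
      (nhds (∫ ω, {ω | slepian B 0 ω < m ∧ ∀ u ≤ s, slepian B u ω ≤ m}.indicator
        (fun _ ↦ (1 : ℝ)) ω ∂P)) := by
    refine tendsto_integral_of_dominated_convergence (fun _ ↦ 1)
      (fun n ↦ (hstay n).aestronglyMeasurable) (integrable_const _)
      (fun n ↦ Filter.Eventually.of_forall fun ω ↦ ?_) ?_
    · exact (norm_indicator_le_norm_self _ _).trans_eq norm_one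
    · filter_upwards [hB.continuous_slepian] with ω hω
      exact tendsto_indicator_staysBelow s m hω
  refine eq_of_forall_dist_le fun ε hε ↦ ?_
  have hex (n k : ℕ) (hk : k ∈ Finset.range (n + 2)) :=
    abs_integral_indicator_firstExceedance_le hB hs m
      (Nat.lt_succ_iff.1 (Finset.mem_range.1 hk) : k ≤ n + 1) hε.le
  set bad : ℕ → ℕ → Set Ω := fun n k ↦ firstExceedance (slepian B) s m n k ∩ {ω | ε <
      |reflectedValue (sBar s - sBar (subdivision s n k)).toNNReal ((m + slepian B 0 ω) / 2)
        ((m - slepian B (subdivision s n k) ω) / (2 - subdivision s n k))|} with hbad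
  set r : ℕ → Ω → ℝ := fun n ω ↦ ∑ k ∈ Finset.range (n + 2),
    (bad n k).indicator (fun ω ↦ |slepianPayoff B s m ω|) ω with hr
  have hfirst (n k : ℕ) (hk : k ∈ Finset.range (n + 2)) :
      Integrable ((firstExceedance (slepian B) s m n k).indicator (slepianPayoff B s m)) P := by
    have h := hgi.indicator₀ (hex n k hk).1
    rwa [Set.indicator_indicator, Set.inter_eq_left.2 fun ω hω ↦ hω.1] at h
  have hbadi (n k : ℕ) (hk : k ∈ Finset.range (n + 2)) :
      Integrable ((bad n k).indicator fun ω ↦ |slepianPayoff B s m ω|) P := by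
    have h := ((hgi.indicator₀ (hex n k hk).2.1)).abs
    rw [Set.indicator_indicator, Set.inter_eq_left.2 fun ω hω ↦ hω.1.1] at h
    refine h.congr (Filter.Eventually.of_forall fun ω ↦ ?_)
    change |(bad n k).indicator _ ω| = _
    by_cases hω : ω ∈ bad n k
    · rw [Set.indicator_of_mem hω, Set.indicator_of_mem hω]
    · rw [Set.indicator_of_notMem hω, Set.indicator_of_notMem hω, abs_zero]
  -- Almost every path ends off level m, so for it all bad events eventually fail; disjointness of
  -- first exceedances gives the dominating function.
  have hrlim : Filter.Tendsto (fun n ↦ ∫ ω, r n ω ∂P) Filter.atTop (nhds 0) := by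
    rw [← integral_zero Ω ℝ (μ := P)]
    refine tendsto_integral_of_dominated_convergence
      (fun ω ↦ |{ω | slepian B 0 ω < m}.indicator (slepianPayoff B s m) ω|)
      (fun n ↦ (integrable_finsetSum _ (hbadi n)).aestronglyMeasurable) hgi.abs
      (fun n ↦ Filter.Eventually.of_forall fun ω ↦ ?_) ?_
    · have hnn (k : ℕ) (ω : Ω) : 0 ≤ (bad n k).indicator (fun ω ↦ |slepianPayoff B s m ω|) ω :=
        Set.indicator_nonneg (fun _ _ ↦ abs_nonneg _) _
      rw [Real.norm_eq_abs, abs_of_nonneg (Finset.sum_nonneg fun k _ ↦ hnn k ω)]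
      refine (Finset.sum_le_sum fun k _ ↦ Set.indicator_le_indicator_of_subset
        Set.inter_subset_left (fun _ ↦ abs_nonneg _) ω).trans
        ((sum_indicator_firstExceedance_le (slepian B) s m n
          (fun ω ↦ abs_nonneg (slepianPayoff B s m ω)) ω).trans_eq ?_)
      by_cases h0 : slepian B 0 ω < m
      · rw [Set.indicator_of_mem (by exact h0), Set.indicator_of_mem (by exact h0)]
      · rw [Set.indicator_of_notMem (by exact h0), Set.indicator_of_notMem (by exact h0), abs_zero]
    · filter_upwards [hB.continuous_slepian, slepian_ne_ae hB s m] with ω hω hend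
      refine tendsto_const_nhds.congr' ?_
      filter_upwards [eventually_abs_reflectedValue_le hs hω hend hε] with n hn
      refine (Finset.sum_eq_zero fun k hk ↦ Set.indicator_of_notMem (fun hmem ↦ ?_) _).symm
      exact absurd (hn k (Nat.lt_succ_iff.1 (Finset.mem_range.1 hk)) hmem.1) (not_le.2 hmem.2)
  have hbound (n : ℕ) :
      |∫ ω, (staysBelow (slepian B) s m n).indicator (fun _ ↦ (1 : ℝ)) ω ∂P -
        ∫ ω, {ω | slepian B 0 ω < m}.indicator (slepianPayoff B s m) ω ∂P| ≤
      ε + ∫ ω, r n ω ∂P := by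
    -- The endpoint s is a grid point, so staying below along the grid forces payoff 1.
    have hpay : (staysBelow (slepian B) s m n).indicator (slepianPayoff B s m) =
        (staysBelow (slepian B) s m n).indicator fun _ ↦ (1 : ℝ) := by
      refine Set.indicator_congr fun ω hω ↦ ?_
      have h := hω.2 (n + 1) le_rfl
      rw [subdivision_last] at h
      exact if_pos (div_nonneg (sub_nonneg.2 h) hs'.le)
    have h1 : ∫ ω, {ω | slepian B 0 ω < m}.indicator (slepianPayoff B s m) ω ∂P =
        ∫ ω, (staysBelow (slepian B) s m n).indicator (fun _ ↦ (1 : ℝ)) ω ∂P +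
        ∑ k ∈ Finset.range (n + 2),
          ∫ ω, (firstExceedance (slepian B) s m n k).indicator (slepianPayoff B s m) ω ∂P := by
      rw [← integral_finsetSum _ (hfirst n), ← integral_add (hstay n)
        (integrable_finsetSum _ (hfirst n))]
      refine integral_congr_ae (Filter.Eventually.of_forall fun ω ↦ ?_)
      change _ = (staysBelow (slepian B) s m n).indicator (fun _ ↦ (1 : ℝ)) ω + _
      rw [← hpay]
      exact indicator_eq_staysBelow_add_sum (slepian B) s m n _ ω
    have hone (k : ℕ) (hk : k ∈ Finset.range (n + 2)) :
        Integrable ((firstExceedance (slepian B) s m n k).indicator fun _ ↦ (1 : ℝ)) P :=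
      (integrable_const _).indicator₀ (hex n k hk).1
    -- The first-exceedance probabilities sum to at most 1, so the total error is ε however fine the
    -- grid.
    have h2 : ∑ k ∈ Finset.range (n + 2),
        ∫ ω, (firstExceedance (slepian B) s m n k).indicator (fun _ ↦ (1 : ℝ)) ω ∂P ≤ 1 := by
      rw [← integral_finsetSum _ hone]
      have h3 := integral_mono (integrable_finsetSum _ hone) (integrable_const (1 : ℝ))
        (μ := P) fun ω ↦ (sum_indicator_firstExceedance_le (slepian B) s m n
          (fun _ ↦ zero_le_one) ω).trans (Set.indicator_le_self' (fun _ _ ↦ zero_le_one) ω)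
      simpa using h3
    rw [h1, abs_sub_comm, add_sub_cancel_left, integral_finsetSum _ (hbadi n)]
    refine (Finset.abs_sum_le_sum_abs _ _).trans
      ((Finset.sum_le_sum fun k hk ↦ (hex n k hk).2.2).trans ?_)
    rw [Finset.sum_add_distrib, ← Finset.mul_sum]
    gcongr
    exact mul_le_of_le_one_right hε.le h2
  have hl := (hlim.sub_const
    (∫ ω, {ω | slepian B 0 ω < m}.indicator (slepianPayoff B s m) ω ∂P)).abs
  have hr0 := hrlim.const_add ε
  rw [add_zero] at hr0
  rw [Real.dist_eq]
  exact le_of_tendsto_of_tendsto' hl hr0 hbound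

/-! ### Measurability and distribution of the running maximum. -/

lemma isGreatest_runningMax {Ω : Type*} {S : ℝ≥0 → Ω → ℝ} (s : ℝ≥0) {ω : Ω}
    (hω : Continuous fun u ↦ S u ω) :
    IsGreatest ((fun u ↦ S u ω) '' Set.Icc 0 s) (runningMax S s ω) :=
  (isCompact_Icc.image hω).isGreatest_sSup ((Set.nonempty_Icc.2 zero_le).image _)

lemma runningMax_le_iff {Ω : Type*} {S : ℝ≥0 → Ω → ℝ} (s : ℝ≥0) {ω : Ω}
    (hω : Continuous fun u ↦ S u ω) (m : ℝ) :
    runningMax S s ω ≤ m ↔ ∀ u ≤ s, S u ω ≤ m := by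
  rw [isLUB_le_iff (isGreatest_runningMax s hω).isLUB, mem_upperBounds, Set.forall_mem_image]
  simp

/-- A countable supremum over grid points, giving measurability; the minimum with s keeps every
index inside [0, s]. -/
lemma runningMax_eq_iSup {Ω : Type*} {S : ℝ≥0 → Ω → ℝ} (s : ℝ≥0) {ω : Ω}
    (hω : Continuous fun u ↦ S u ω) :
    runningMax S s ω = ⨆ p : ℕ × ℕ, S (min s (subdivision s p.1 p.2)) ω := by
  have hg := isGreatest_runningMax s hω
  have hle (p : ℕ × ℕ) : S (min s (subdivision s p.1 p.2)) ω ≤ runningMax S s ω :=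
    hg.2 ⟨_, ⟨zero_le, min_le_left _ _⟩, rfl⟩
  have hbdd : BddAbove (Set.range fun p : ℕ × ℕ ↦ S (min s (subdivision s p.1 p.2)) ω) :=
    ⟨_, Set.forall_mem_range.2 hle⟩
  refine le_antisymm ((runningMax_le_iff s hω _).2 fun u hu ↦ ?_) (ciSup_le hle)
  have hclosed : IsClosed {v | S v ω ≤ ⨆ p : ℕ × ℕ, S (min s (subdivision s p.1 p.2)) ω} :=
    isClosed_le hω continuous_const
  refine hclosed.closure_subset (Metric.mem_closure_iff.2 fun δ hδ ↦ ?_)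
  obtain ⟨n, hn⟩ := ((tendsto_div_succ s).eventually (gt_mem_nhds hδ)).exists
  obtain ⟨k, hk, hd⟩ := exists_dist_subdivision_le hu n
  refine ⟨subdivision s n k, ?_, by rw [dist_comm]; exact hd.trans_lt hn⟩
  have h := le_ciSup hbdd (n, k)
  simp only [min_eq_right (subdivision_le s hk)] at h
  exact h

lemma aemeasurable_runningMax_slepian {Ω : Type*} [MeasurableSpace Ω] {P : Measure Ω}
    {B : ℝ≥0 → Ω → ℝ} (hB : IsBrownianReal B P) (s : ℝ≥0) :
    AEMeasurable (runningMax (slepian B) s) P := by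
  refine (AEMeasurable.iSup fun p : ℕ × ℕ ↦
    hB.aemeasurable_slepian (min s (subdivision s p.1 p.2))).congr ?_
  filter_upwards [hB.continuous_slepian] with ω hω
  exact (runningMax_eq_iSup s hω).symm

lemma measureReal_runningMax_slepian_le {Ω : Type*} [MeasurableSpace Ω] {P : Measure Ω}
    [IsProbabilityMeasure P] {B : ℝ≥0 → Ω → ℝ} (hB : IsBrownianReal B P) {s : ℝ≥0} (hs : s ≤ 1)
    (m : ℝ) :
    P.real {ω | runningMax (slepian B) s ω ≤ m} =
      ∫ ω, {ω | slepian B 0 ω < m}.indicator (slepianPayoff B s m) ω ∂P := by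
  have hnull : NullMeasurableSet {ω | runningMax (slepian B) s ω ≤ m} P :=
    nullMeasurableSet_le (aemeasurable_runningMax_slepian hB s) aemeasurable_const
  rw [← integral_indicator_forall_slepian_le hB hs, ← mul_one (P.real _), ← smul_eq_mul,
    ← setIntegral_const, ← integral_indicator₀ hnull]
  refine integral_congr_ae ?_
  filter_upwards [hB.continuous_slepian, slepian_ne_ae hB 0 m] with ω hω h0
  have h : ω ∈ {ω | runningMax (slepian B) s ω ≤ m} ↔
      ω ∈ {ω | slepian B 0 ω < m ∧ ∀ u ≤ s, slepian B u ω ≤ m} :=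
    (runningMax_le_iff s hω m).trans
      ⟨fun h ↦ ⟨lt_of_le_of_ne (h 0 zero_le) h0, h⟩, fun h ↦ h.2⟩
  by_cases h1 : ω ∈ {ω | runningMax (slepian B) s ω ≤ m}
  · rw [Set.indicator_of_mem h1, Set.indicator_of_mem (h.1 h1)]
  · rw [Set.indicator_of_notMem h1, Set.indicator_of_notMem (fun h2 ↦ h1 (h.2 h2))]

/-! ### Integration over the initial value and the closed formula. -/

lemma integral_slepianPayoff {Ω : Type*} [MeasurableSpace Ω] {P : Measure Ω}
    [IsProbabilityMeasure P] {B : ℝ≥0 → Ω → ℝ} (hB : IsBrownianReal B P) {s : ℝ≥0} (hs : s ≤ 1)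
    (m : ℝ) :
    Integrable ((Set.Iio m).indicator fun x ↦
        reflectedValue (sBar s).toNNReal ((m + x) / 2) ((m - x) / 2)) (gaussianReal 0 1) ∧
      ∫ ω, {ω | slepian B 0 ω < m}.indicator (slepianPayoff B s m) ω ∂P =
        ∫ x, (Set.Iio m).indicator (fun x ↦
          reflectedValue (sBar s).toNNReal ((m + x) / 2) ((m - x) / 2)) x ∂gaussianReal 0 1 := by
  have hlaw := hB.hasLaw_pinnedIncrement (zero_le (a := s)) hs
  have hind : IndepFun (slepian B 0) (pinnedIncrement B s 0) P :=
    (hB.indepFun_pinnedIncrement (zero_le (a := s)) hs).comp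
      (measurable_pi_apply (⟨0, Set.self_mem_Iic⟩ : Set.Iic (0 : ℝ≥0))) measurable_id
  rw [sBar_zero, sub_zero] at hlaw
  set τ := (sBar s).toNNReal with hτ
  set f : ℝ × ℝ → ℝ := fun q ↦ (Set.Iio m).indicator (fun _ ↦ (1 : ℝ)) q.1 *
    reflectedPayoff ((m + q.1) / 2) ((m - q.1) / 2 + (m + q.1) / 2 * τ - q.2) with hfdef
  have hf : Measurable f := by
    refine ((measurable_const.indicator measurableSet_Iio).comp measurable_fst).mul
      (measurable_reflectedPayoff.comp (Measurable.prodMk ?_ ?_)) <;> fun_prop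
  have heq : (fun ω ↦ f (slepian B 0 ω, pinnedIncrement B s 0 ω)) =
      {ω | slepian B 0 ω < m}.indicator (slepianPayoff B s m) := by
    ext ω
    have h := div_eq_add_sub_pinnedIncrement B (zero_le (a := s)) hs m ω
    rw [sBar_zero, sub_zero, ← hτ, NNReal.coe_zero, sub_zero] at h
    by_cases h0 : slepian B 0 ω < m
    · simp only [hfdef]
      rw [Set.indicator_of_mem (by exact h0), Set.indicator_of_mem (by exact h0), one_mul,
        slepianPayoff, h]
    · simp only [hfdef]
      rw [Set.indicator_of_notMem (by exact h0), Set.indicator_of_notMem (by exact h0), zero_mul]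
  have hinner : (fun x ↦ ∫ z, f (x, z) ∂gaussianReal 0 τ) = (Set.Iio m).indicator fun x ↦
      reflectedValue τ ((m + x) / 2) ((m - x) / 2) := by
    ext x
    simp only [hfdef]
    rw [integral_const_mul]
    by_cases h0 : x < m
    · rw [Set.indicator_of_mem (by exact h0), Set.indicator_of_mem (by exact h0), one_mul]
      rfl
    · rw [Set.indicator_of_notMem (by exact h0), Set.indicator_of_notMem (by exact h0), zero_mul]
  have h := integral_comp_prodMk_of_indepFun (hB.aemeasurable_slepian 0) hlaw hind hf
    (heq ▸ integrable_slepianPayoff hB hs m)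
  rw [hinner, heq, (hB.hasLaw_slepian 0).map_eq] at h
  refine ⟨h.1, h.2.trans ?_⟩
  rw [← hinner]

lemma gaussianPDFReal_zero_one (x : ℝ) :
    gaussianPDFReal 0 1 x = 1 / √(2 * Real.pi) * Real.exp (-x ^ 2 / 2) := by
  simp [gaussianPDFReal]

lemma integrable_exp_neg_sq_div_two : Integrable fun x : ℝ ↦ Real.exp (-x ^ 2 / 2) := by
  have h := integrable_exp_neg_mul_sq (b := 1 / 2) (by norm_num)
  refine h.congr (Filter.Eventually.of_forall fun x ↦ ?_)
  change Real.exp _ = Real.exp _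
  congr 1
  ring

lemma integrable_gaussianReal_iff {v : ℝ≥0} (hv : v ≠ 0) (μ : ℝ) (f : ℝ → ℝ) :
    Integrable f (gaussianReal μ v) ↔ Integrable fun x ↦ gaussianPDFReal μ v x * f x := by
  rw [gaussianReal_of_var_ne_zero _ hv, integrable_withDensity_iff_integrable_smul'
    (measurable_gaussianPDF μ v) (Filter.Eventually.of_forall fun _ ↦ gaussianPDF_lt_top)]
  simp

/-- The exponents combine as x²/2 + (m+x)(m-x)/2 = m²/2, so the second Gaussian weight no longer
depends on x. -/
lemma exp_mul_reflectedValue {τ : ℝ} (hτ : 0 < τ) (m x : ℝ) :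
    Real.exp (-x ^ 2 / 2) * reflectedValue τ.toNNReal ((m + x) / 2) ((m - x) / 2) =
      Real.exp (-x ^ 2 / 2) * stdNormalCDF ((m - x) / (2 * √τ) + (m + x) / 2 * √τ) -
      Real.exp (-m ^ 2 / 2) * stdNormalCDF (-((m - x) / (2 * √τ)) + (m + x) / 2 * √τ) := by
  rw [reflectedValue_eq (Real.toNNReal_pos.2 hτ), Real.coe_toNNReal _ hτ.le, div_div, mul_sub,
    ← mul_assoc, ← Real.exp_add]
  congr 3
  ring

theorem theorem1 {Ω : Type*} [MeasurableSpace Ω] (P : Measure Ω) [IsProbabilityMeasure P]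
    (B : ℝ≥0 → Ω → ℝ) (hB : IsBrownianReal B P) (s : ℝ≥0) (hs : s ≤ 1) :
    AEMeasurable (runningMax (slepian B) s) P ∧
    (∀ᵐ ω ∂P, IsGreatest ((fun u => slepian B u ω) '' Set.Icc 0 s)
      (runningMax (slepian B) s ω)) ∧
    (0 < s → ∀ m : ℝ,
      IntegrableOn (fun x : ℝ => Real.exp (-x ^ 2 / 2) *
        stdNormalCDF ((m - x) / (2 * √(sBar s)) + (m + x) / 2 * √(sBar s))) (Set.Iic m) ∧
      IntegrableOn (fun x : ℝ =>
        stdNormalCDF (-((m - x) / (2 * √(sBar s))) + (m + x) / 2 * √(sBar s))) (Set.Iic m) ∧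
      P.real {ω | runningMax (slepian B) s ω ≤ m} =
        (1 / √(2 * Real.pi)) * (∫ x in Set.Iic m, Real.exp (-x ^ 2 / 2) *
          stdNormalCDF ((m - x) / (2 * √(sBar s)) + (m + x) / 2 * √(sBar s)))
        - (1 / √(2 * Real.pi)) * Real.exp (-m ^ 2 / 2) * (∫ x in Set.Iic m,
          stdNormalCDF (-((m - x) / (2 * √(sBar s))) + (m + x) / 2 * √(sBar s)))) ∧
    (s = 0 → ∀ m : ℝ,
      P.real {ω | runningMax (slepian B) s ω ≤ m} =
        (1 / √(2 * Real.pi)) * (∫ x in Set.Iic m, Real.exp (-x ^ 2 / 2))) := by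
  refine ⟨aemeasurable_runningMax_slepian hB s, ?_, fun h0 m ↦ ?_, fun h0 m ↦ ?_⟩
  · filter_upwards [hB.continuous_slepian] with ω hω
    exact isGreatest_runningMax s hω
  · have hT : 0 < sBar s := sBar_pos h0 hs
    have hc : 0 < 1 / √(2 * Real.pi) := by positivity
    obtain ⟨hi, hval⟩ := integral_slepianPayoff hB hs m
    have hpoint (x : ℝ) : gaussianPDFReal 0 1 x * (Set.Iio m).indicator (fun x ↦
        reflectedValue (sBar s).toNNReal ((m + x) / 2) ((m - x) / 2)) x =
        1 / √(2 * Real.pi) * (Set.Iio m).indicator (fun x ↦ Real.exp (-x ^ 2 / 2) *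
          stdNormalCDF ((m - x) / (2 * √(sBar s)) + (m + x) / 2 * √(sBar s)) -
          Real.exp (-m ^ 2 / 2) *
          stdNormalCDF (-((m - x) / (2 * √(sBar s))) + (m + x) / 2 * √(sBar s))) x := by
      rw [gaussianPDFReal_zero_one, mul_assoc]
      by_cases hx : x ∈ Set.Iio m
      · rw [Set.indicator_of_mem hx, Set.indicator_of_mem hx, exp_mul_reflectedValue hT]
      · rw [Set.indicator_of_notMem hx, Set.indicator_of_notMem hx, mul_zero]
    rw [integrable_gaussianReal_iff one_ne_zero] at hi
    simp_rw [hpoint] at hi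
    rw [integrable_const_mul_iff hc.ne'.isUnit, integrable_indicator_iff measurableSet_Iio,
      ← integrableOn_Iic_iff_integrableOn_Iio] at hi
    have hfirst : IntegrableOn (fun x : ℝ => Real.exp (-x ^ 2 / 2) *
        stdNormalCDF ((m - x) / (2 * √(sBar s)) + (m + x) / 2 * √(sBar s))) (Set.Iic m) := by
      refine (integrable_exp_neg_sq_div_two.mul_bdd (c := 1)
        (measurable_stdNormalCDF.comp (by fun_prop)).aestronglyMeasurable
        (Filter.Eventually.of_forall fun x ↦ abs_stdNormalCDF_le_one _)).integrableOn
    -- No tail estimate is needed: the first term and the difference of the two are already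
    -- integrable.
    have hsecond' : IntegrableOn (fun x : ℝ => Real.exp (-m ^ 2 / 2) *
        stdNormalCDF (-((m - x) / (2 * √(sBar s))) + (m + x) / 2 * √(sBar s))) (Set.Iic m) := by
      refine (hfirst.sub hi).congr (Filter.Eventually.of_forall fun x ↦ ?_)
      simp only [Pi.sub_apply]
      ring
    refine ⟨hfirst, ?_, ?_⟩
    · exact (integrable_const_mul_iff (Real.exp_pos _).ne'.isUnit _).1 hsecond'
    · rw [measureReal_runningMax_slepian_le hB hs, hval,
        integral_gaussianReal_eq_integral_smul one_ne_zero]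
      simp_rw [smul_eq_mul, hpoint]
      rw [integral_const_mul, integral_indicator measurableSet_Iio, ← integral_Iic_eq_integral_Iio,
        integral_sub hfirst hsecond', integral_const_mul]
      ring
  · subst h0
    have h (ω : Ω) : runningMax (slepian B) 0 ω = slepian B 0 ω := by
      simp [runningMax]
    simp_rw [h]
    rw [(hB.hasLaw_slepian 0).measureReal_eq (p := fun x ↦ x ≤ m) measurableSet_Iic,
      measureReal_def, gaussianReal_apply_eq_integral 0 one_ne_zero,
      ENNReal.toReal_ofReal (integral_nonneg fun z ↦ gaussianPDFReal_nonneg _ _ _)]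
    simp_rw [gaussianPDFReal_zero_one]
    rw [integral_const_mul]
    rfl
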